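/- Let $n\in\mathbb N$, let $\mathcal S=\mathbb R^{n\times 1}$ and $\mathcal S^*=\mathbb R^{1\times n}$ carry their Euclidean norms, and consider the controlled linear system $$\dot{\boldsymbol s}=\boldsymbol A(t)\boldsymbol s+\boldsymbol u(t),\qquad \boldsymbol s(0)=\mathbf s_0\in\mathcal S,$$ where $\boldsymbol A$ is a measurable matrix-valued function that is locally integrable on $[0,\infty)$. Admissible controls are the measurable functions $\boldsymbol u$ with $\boldsymbol u(t)\in\mathcal U$ for all $t\ge 0$, where $\mathcal U\subset\mathcal S$ is nonempty and compact; $\boldsymbol s(\cdot;\boldsymbol u)$ is the absolutely continuous solution and $\mathcal R(t)=\{\boldsymbol s(t;\boldsymbol u):\boldsymbol u \text{ admissible}\}$ is the reachable set at time $t\geq 0$. Let $\mathcal G(t)\subset\mathcal S$, $t\in\mathbb R$, be the target sets. For $\mathcal M\subset\mathcal S$ and $\mathbf p\in\mathcal S^*$, $\mathbf p\ne\boldsymbol 0$, let $\boldsymbol s_{\mathcal M}(\mathbf p)=\arg\max_{\mathbf s\in\mathcal M}\mathbf p\mathbf s$ be the contact function, and put $$\rho_{\mathrm{lower}}(t,\mathbf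 p)=\frac{\mathbf p}{\lVert\mathbf p\rVert}\bigl(\boldsymbol s_{\mathcal G(t)}(-\mathbf p)-\boldsymbol s_{\mathcal R(t)}(\mathbf p)\bigr).$$ Assume: - (RP1) for all $t\ge0$ and admissible $\boldsymbol u_1,\boldsymbol u_2$: if $\boldsymbol s(t;\boldsymbol u_1)=\boldsymbol s(t;\boldsymbol u_2)\in\partial\mathcal R(t)$, then $\boldsymbol u_1=\boldsymbol u_2$ almost everywhere on $[0,t]$; - (RP2) $v_{\mathcal R}>0$ and $\lVert\boldsymbol A(t)\boldsymbol s(t;\boldsymbol u)+\boldsymbol u(t)\rVert\le v_{\mathcal R}$ for all admissible $\boldsymbol u$ and all $t\ge0$; - (RT4) every $\mathcal G(t)$ is a nonempty strictly convex compact set, $\mathcal G$ is continuous in the Hausdorff distance, and for every $\mathbf p\in\mathcal S^*$, $\mathbf p\ne\boldsymbol0$, the function $t\mapsto\boldsymbol s_{\mathcal G(t)}(\mathbf p)$ is (continuous and) differentiable on $\mathbb R$ with $\bigl\lVert\frac{\partial}{\partial t}\boldsymbol s_{\mathcal G(t)}(\mathbf p)\bigr\rVert\le v_{\mathcal G}$,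 where $v_{\mathcal G}\geq 0$ is a constant independent of $t$ and $\mathbf p$. Define the simple boosting-time function by $f(T,\mathbf p)=T+\rho_{\mathrm{lower}}(T,\mathbf p)/(v_{\mathcal G}+v_{\mathcal R})$ if $\rho_{\mathrm{lower}}(T,\mathbf p)\ge0$ and $f(T,\mathbf p)=T$ otherwise. Let $T\ge0$, $\mathbf p\in\mathcal S^*$, $\mathbf p\neq\boldsymbol0$ and $\rho_{\mathrm{lower}}(T,\mathbf p)>0$. Then $$\rho_{\mathrm{lower}}(t,\mathbf p)>0\quad\text{for all } t\in[T,f(T,\mathbf p)),\qquad\text{and}\qquad \rho_{\mathrm{lower}}(f(T,\mathbf p),\mathbf p)\ge0.$$ Consequently, the simple boosting-time function preserves separability: for every $t\in[T,f(T,\mathbf p))$ there is $c\in\mathbb R$ with $\mathbf p\mathbf s<c<\mathbf p\tilde{\mathbf s}$ for all $\mathbf s\in\mathcal R(t)$, $\tilde{\mathbf s}\in\mathcal G(t)$, and for $t=f(T,\mathbf p)$ there is $c\in\mathbb R$ with $\mathbf p\mathbf s\le c\le\mathbf p\tilde{\mathbf s}$ for all $\mathbf s\in\mathcal R(t)$,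 $\tilde{\mathbf s}\in\mathcal G(t)$. -/

import Mathlib

open MeasureTheory Filter Topology Set
open scoped RealInnerProductSpace

noncomputable section

namespace MinTime

/-- The state space of column vectors `ℝⁿ` with the Euclidean norm. -/
abbrev State (n : ℕ) := EuclideanSpace ℝ (Fin n)

/-- The conjugate space of row vectors with the Euclidean norm; the product `p s` of a row `p`
and a column `s` is `⟪p, s⟫ = ∑ i, p i * s i`. -/
abbrev Costate (n : ℕ) := EuclideanSpace ℝ (Fin n)

/-- The data of the controlled linear system `ṡ = A(t) s + u`, `s(0) = s₀`, `u(t) ∈ U`. Local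
integrability of the entries of `A` on `[0, ∞)` contains their (Lebesgue) measurability, and is
what makes the system have an absolutely continuous fundamental matrix on `[0, ∞)`. -/
structure LinearPlant (n : ℕ) where
  A : ℝ → Matrix (Fin n) (Fin n) ℝ
  s₀ : State n
  U : Set (State n)
  locallyIntegrable_A : ∀ i j, LocallyIntegrableOn (fun t => A t i j) (Ici 0) volume
  isCompact_U : IsCompact U
  nonempty_U : U.Nonempty

variable {n : ℕ}

namespace LinearPlant

/-- The right-hand side `A(t) s + u` of the dynamics. -/
def velocity (P : LinearPlant n) (t : ℝ) (s u : State n) : State n :=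
  Matrix.toEuclideanLin (P.A t) s + u

/-- The set of admissible control inputs: measurable functions with values in `U` (only the values
at times `t ≥ 0` matter). -/
def admissible (P : LinearPlant n) : Set (ℝ → State n) :=
  {u | Measurable u ∧ ∀ t, 0 ≤ t → u t ∈ P.U}

/-- `s` is the state trajectory `s(·; u)` on `[0, ∞)`: the absolutely continuous solution of
`ṡ = A s + u` with `s(0) = s₀`. -/
structure IsTrajectory (P : LinearPlant n) (u s : ℝ → State n) : Prop where
  initial : s 0 = P.s₀
  absolutelyContinuous : ∀ t, 0 ≤ t → AbsolutelyContinuousOnInterval s 0 t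
  hasDerivAt : ∀ᵐ t : ℝ, 0 ≤ t → HasDerivAt s (P.velocity t (s t) (u t)) t

/-- The reachable set `R(t)`. -/
def reachable (P : LinearPlant n) (t : ℝ) : Set (State n) :=
  {x | ∃ u ∈ P.admissible, ∃ s, P.IsTrajectory u s ∧ s t = x}

/-- Requirement RP1 (normality). -/
def RP1 (P : LinearPlant n) : Prop :=
  ∀ t, 0 ≤ t → ∀ u₁ ∈ P.admissible, ∀ u₂ ∈ P.admissible, ∀ s₁ s₂,
    P.IsTrajectory u₁ s₁ → P.IsTrajectory u₂ s₂ →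
    s₁ t = s₂ t → s₁ t ∈ frontier (P.reachable t) →
    ∀ᵐ τ : ℝ, τ ∈ Icc 0 t → u₁ τ = u₂ τ

/-- Requirement RP2 (speed limit of the plant) with the constant `vR > 0`. -/
def RP2 (P : LinearPlant n) (vR : ℝ) : Prop :=
  0 < vR ∧ ∀ u ∈ P.admissible, ∀ s, P.IsTrajectory u s →
    ∀ t, 0 ≤ t → ‖P.velocity t (s t) (u t)‖ ≤ vR

end LinearPlant

open Classical in
/-- The contact function `s_M(p) = argmax_{s ∈ M} p s` (and `0` if there is no maximizer). -/
def contactPoint (M : Set (State n)) (p : Costate n) : State n :=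
  if h : ∃ s ∈ M, ∀ s' ∈ M, ⟪p, s'⟫ ≤ ⟪p, s⟫ then h.choose else 0

/-- Requirement RT1 (simple geometry). -/
structure RT1 (G : ℝ → Set (State n)) : Prop where
  nonempty : ∀ t, (G t).Nonempty
  isCompact : ∀ t, IsCompact (G t)
  strictConvex : ∀ t, StrictConvex ℝ (G t)

/-- Requirement RT2 (continuity): `G` is continuous for the Hausdorff distance, and so is
`t ↦ s_{G(t)}(p)` for each `p ≠ 0`. -/
structure RT2 (G : ℝ → Set (State n)) : Prop extends RT1 G where
  continuous_set : ∀ t, Tendsto (fun τ => Metric.hausdorffDist (G τ) (G t)) (𝓝 t) (𝓝 0)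
  continuous_contact : ∀ p : Costate n, p ≠ 0 → Continuous fun t => contactPoint (G t) p

/-- Requirement RT3 (differentiability). -/
structure RT3 (G : ℝ → Set (State n)) : Prop extends RT2 G where
  differentiable_contact : ∀ p : Costate n, p ≠ 0 → Differentiable ℝ fun t => contactPoint (G t) p

/-- The velocity `v_{G(t)}(p)` of the contact point of the target set. -/
def contactVelocity (G : ℝ → Set (State n)) (t : ℝ) (p : Costate n) : State n :=
  deriv (fun τ => contactPoint (G τ) p) t

/-- Requirement RT4 (speed limit of the target set) with the constant `vG ≥ 0`. -/
structure RT4 (G : ℝ → Set (State n)) (vG : ℝ) : Prop extends RT3 G where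
  nonneg : 0 ≤ vG
  norm_contactVelocity_le : ∀ t, ∀ p : Costate n, p ≠ 0 → ‖contactVelocity G t p‖ ≤ vG

/-- The lower estimate `ρ_lower(t, p) = (p / ‖p‖) (s_{G(t)}(-p) - s_{R(t)}(p))` of the distance
between the reachable set and the target set. -/
def rhoLower (P : LinearPlant n) (G : ℝ → Set (State n)) (t : ℝ) (p : Costate n) : ℝ :=
  ⟪‖p‖⁻¹ • p, contactPoint (G t) (-p) - contactPoint (P.reachable t) p⟫

/-- The simple boosting-time function `f(T, p)`. -/
def simpleBoost (P : LinearPlant n) (G : ℝ → Set (State n)) (vR vG T : ℝ) (p : Costate n) : ℝ :=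
  if 0 ≤ rhoLower P G T p then T + rhoLower P G T p / (vG + vR) else T

end MinTime

end

/-! Up to the factor `‖p‖`, `rhoLower` is the minimum of `p` over `G t` minus its maximum over the
reachable set. The minimum falls at rate at most `‖p‖ * vG`, by the mean value inequality for the
contact point in direction `-p`. The maximum rises at rate at most `‖p‖ * vR`: a trajectory optimal
at the later time was reachable at the earlier one, and its speed is bounded by `vR`. Hence
`rhoLower` falls at rate at most `vG + vR` (`rhoLower_ge`), and the boosting time is exactly when
this linear lower bound reaches zero.

The labour lies in showing that the maximum over the reachable set is attained, since `contactPoint`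
is the junk value `0` otherwise. `exists_max_reachable` builds an optimal control by the maximum
principle: solve the adjoint equation backward from `p` and apply a Borel argmax selector of `U` to
the costate. This needs Carathéodory solutions of linear equations with integrable coefficients. -/

noncomputable section

namespace MinTime

/-! ### Absolutely continuous functions -/

section AbsolutelyContinuous

theorem absolutelyContinuousOnInterval_of_dist_le {X Y : Type*} [PseudoMetricSpace X]
    [PseudoMetricSpace Y] {f : ℝ → X} {g : ℝ → Y} {a b : ℝ}
    (hf : AbsolutelyContinuousOnInterval f a b)
    (h : ∀ x ∈ uIcc a b, ∀ y ∈ uIcc a b, dist (g x) (g y) ≤ dist (f x) (f y)) :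
    AbsolutelyContinuousOnInterval g a b := by
  rw [absolutelyContinuousOnInterval_iff] at hf ⊢
  intro ε hε
  obtain ⟨δ, hδ, H⟩ := hf ε hε
  refine ⟨δ, hδ, fun E hE hlen => lt_of_le_of_lt (Finset.sum_le_sum fun i hi => ?_) (H E hE hlen)⟩
  exact h _ (hE.1 i hi).1 _ (hE.1 i hi).2

/-- Polarization reduces this to squares of norms, and the norm is 1-Lipschitz. -/
theorem absolutelyContinuousOnInterval_inner {E : Type*} [NormedAddCommGroup E]
    [InnerProductSpace ℝ E] {f g : ℝ → E} {a b : ℝ} (hf : AbsolutelyContinuousOnInterval f a b)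
    (hg : AbsolutelyContinuousOnInterval g a b) :
    AbsolutelyContinuousOnInterval (fun t => ⟪f t, g t⟫) a b := by
  have hnorm : ∀ {h : ℝ → E}, AbsolutelyContinuousOnInterval h a b →
      AbsolutelyContinuousOnInterval (fun t => ‖h t‖) a b := fun hh =>
    absolutelyContinuousOnInterval_of_dist_le hh fun x _ y _ => by
      simpa only [dist_eq_norm] using dist_norm_norm_le (_ : E) _
  have h1 := hnorm (hf.add hg)
  have h2 := hnorm (hf.sub hg)
  have := ((h1.mul h1).sub (h2.mul h2)).const_mul (1 / 4)
  convert! this using 1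
  ext t
  have hadd := norm_add_mul_self_real (f t) (g t)
  have hsub := norm_sub_mul_self_real (f t) (g t)
  simp only [Pi.mul_apply, Pi.sub_apply, Pi.add_apply]
  linarith

theorem absolutelyContinuousOnInterval_primitive {E : Type*} [NormedAddCommGroup E]
    [NormedSpace ℝ E] {f : ℝ → E} {a b : ℝ} (hf : IntervalIntegrable f volume a b) (c : E) :
    AbsolutelyContinuousOnInterval (fun t => c + ∫ τ in a..t, f τ) a b := by
  refine absolutelyContinuousOnInterval_of_dist_le
    (hf.norm.absolutelyContinuousOnInterval_intervalIntegral left_mem_uIcc) fun x hx y hy => ?_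
  have hI : ∀ z ∈ uIcc a b, IntervalIntegrable f volume a z := fun z hz =>
    hf.mono_set (uIcc_subset_uIcc_left hz)
  rw [dist_comm, dist_comm (∫ τ in a..x, ‖f τ‖), dist_add_left, dist_eq_norm, Real.dist_eq,
    intervalIntegral.integral_interval_sub_left (hI y hy) (hI x hx),
    intervalIntegral.integral_interval_sub_left (hI y hy).norm (hI x hx).norm]
  exact intervalIntegral.norm_integral_le_abs_integral_norm

/-- Absolute continuity makes the increment the integral of the derivative, so almost everywhere
bounds suffice. -/
theorem AbsolutelyContinuousOnInterval.sub_le_of_deriv_le {f f' : ℝ → ℝ} {a b C : ℝ}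
    (hf : AbsolutelyContinuousOnInterval f a b) (hab : a ≤ b)
    (hd : ∀ᵐ t, t ∈ Icc a b → HasDerivAt f (f' t) t) (hC : ∀ᵐ t, t ∈ Icc a b → f' t ≤ C) :
    f b - f a ≤ C * (b - a) := by
  rw [← hf.integral_deriv_eq_sub]
  calc ∫ x in a..b, deriv f x ≤ ∫ _ in a..b, C := by
        refine intervalIntegral.integral_mono_ae_restrict hab hf.intervalIntegrable_deriv
          intervalIntegrable_const ?_
        rw [EventuallyLE, ae_restrict_iff' measurableSet_Icc]
        filter_upwards [hd, hC] with x h1 h2 hx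
        rw [(h1 hx).deriv]
        exact h2 hx
    _ = C * (b - a) := by simp [mul_comm]

end AbsolutelyContinuous

/-! ### Measurable selection -/

/-- A compact set of Euclidean space has a Borel selection of maximizers of linear functionals. -/
theorem exists_measurable_argmax {E : Type*} [NormedAddCommGroup E] [InnerProductSpace ℝ E]
    [MeasurableSpace E] [BorelSpace E] {U : Set E} (hU : IsCompact U) (hne : U.Nonempty) :
    ∃ σ : E → E, Measurable σ ∧ ∀ w, σ w ∈ U ∧ ∀ u ∈ U, ⟪w, u⟫ ≤ ⟪w, σ w⟫ := by
  have : CompactSpace U := isCompact_iff_compactSpace.1 hU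
  have : Nonempty U := hne.to_subtype
  have : CompactSpace cantorSet := isCompact_iff_compactSpace.1 isCompact_cantorSet
  -- A Cantor parametrization of `U` orders its points: among the parameters of maximizers, a
  -- compact set, the least one is a canonical choice.
  obtain ⟨f, hf, hfs⟩ := exists_nat_bool_continuous_surjective_of_compact U
  let c : cantorSet → U := f ∘ cantorSetHomeomorphNatToBool
  have hc : Continuous c := hf.comp cantorSetHomeomorphNatToBool.continuous
  have hcs : Function.Surjective c := hfs.comp cantorSetHomeomorphNatToBool.surjective
  let S : E → Set cantorSet := fun w => {ξ | ∀ u ∈ U, ⟪w, u⟫ ≤ ⟪w, (c ξ : E)⟫}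
  have hclosed : IsClosed {z : cantorSet × E | z.1 ∈ S z.2} := by
    have : {z : cantorSet × E | z.1 ∈ S z.2} =
        ⋂ u ∈ U, {z : cantorSet × E | ⟪z.2, u⟫ ≤ ⟪z.2, (c z.1 : E)⟫} := by
      ext z
      simp [S]
    rw [this]
    exact isClosed_biInter fun u _ => isClosed_le (by fun_prop) (by fun_prop)
  have hSne : ∀ w, (S w).Nonempty := fun w => by
    obtain ⟨v, hv, hmax⟩ := hU.exists_isMaxOn hne
      (f := fun u => ⟪w, u⟫) (by fun_prop)
    obtain ⟨ξ, hξ⟩ := hcs ⟨v, hv⟩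
    exact ⟨ξ, fun u hu => by rw [hξ]; exact hmax hu⟩
  have hSc : ∀ w, IsCompact (S w) := fun w =>
    (hclosed.preimage (Continuous.prodMk_left w)).isCompact
  choose ξ hξ hmin using fun w => (hSc w).exists_isMinOn (hSne w)
    (f := fun x : cantorSet => (x : ℝ)) (by fun_prop)
  have hmeas : Measurable ξ := by
    refine Measurable.subtype_mk (f := fun w => (ξ w : ℝ)) (measurable_of_Iic fun a => ?_)
    -- Sublevel sets of the least parameter are projections of closed sets along a compact factor,
    -- hence closed.
    have : (fun w => (ξ w : ℝ)) ⁻¹' Iic a =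
        Prod.snd '' ({z : cantorSet × E | z.1 ∈ S z.2} ∩ {z | (z.1 : ℝ) ≤ a}) := by
      ext w
      constructor
      · intro h
        exact ⟨(ξ w, w), ⟨hξ w, h⟩, rfl⟩
      · rintro ⟨⟨x, w'⟩, ⟨h1, h2⟩, rfl⟩
        exact (show (ξ w' : ℝ) ≤ x from hmin w' h1).trans h2
    rw [this]
    exact (isClosedMap_snd_of_compactSpace _
      (hclosed.inter (isClosed_le (by fun_prop) continuous_const))).measurableSet
  exact ⟨fun w => c (ξ w), measurable_subtype_coe.comp (hc.measurable.comp hmeas),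
    fun w => ⟨(c (ξ w)).2, hξ w⟩⟩

/-! ### Linear equations with integrable coefficients -/

section LinearODE

/-- The power rule for a primitive of a merely integrable `β`, valid because powers of the primitive
are absolutely continuous. It supplies the factorials in the Picard bound. -/
theorem integral_mul_primitive_pow {β : ℝ → ℝ} {t : ℝ} (hβ : IntervalIntegrable β volume 0 t)
    (k : ℕ) :
    ∫ τ in (0 : ℝ)..t, β τ * ((∫ r in (0 : ℝ)..τ, β r) ^ k / k.factorial) =
      (∫ r in (0 : ℝ)..t, β r) ^ (k + 1) / (k + 1).factorial := by
  have hm := hβ.absolutelyContinuousOnInterval_intervalIntegral left_mem_uIcc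
  have hpow : ∀ j : ℕ, AbsolutelyContinuousOnInterval
      (fun τ => (∫ r in (0 : ℝ)..τ, β r) ^ (j + 1)) 0 t := by
    intro j
    induction j with
    | zero => simpa using hm
    | succ j ih => simpa only [pow_succ _ (j + 1)] using ih.fun_mul hm
  have h := ((hpow k).const_mul (1 / ((k + 1).factorial : ℝ))).integral_deriv_eq_sub
  have h0 : (∫ r in (0 : ℝ)..t, β r) ^ (k + 1) / (k + 1).factorial =
      1 / ((k + 1).factorial : ℝ) * (∫ r in (0 : ℝ)..t, β r) ^ (k + 1) -
      1 / ((k + 1).factorial : ℝ) * (∫ r in (0 : ℝ)..0, β r) ^ (k + 1) := by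
    simp
    ring
  rw [h0, ← h]
  refine intervalIntegral.integral_congr_ae ?_
  filter_upwards [hβ.ae_hasDerivAt_integral] with τ hτ hmem
  have hd := ((hτ (uIoc_subset_uIcc hmem) 0 left_mem_uIcc).pow (k + 1)).const_mul
    (1 / ((k + 1).factorial : ℝ))
  rw [HasDerivAt.deriv (f := fun x => 1 / ((k + 1).factorial : ℝ) *
    (∫ r in (0 : ℝ)..x, β r) ^ (k + 1)) hd, Nat.factorial_succ]
  have : (k.factorial : ℝ) ≠ 0 := by positivity
  push_cast
  field_simp

variable {E : Type*} [NormedAddCommGroup E] [NormedSpace ℝ E]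

theorem intervalIntegrable_clm_apply {B : ℝ → E →L[ℝ] E} {y : ℝ → E} {a b : ℝ}
    (hB : IntervalIntegrable B volume a b) (hy : ContinuousOn y (uIcc a b)) :
    IntervalIntegrable (fun τ => B τ (y τ)) volume a b := by
  obtain ⟨C, hC⟩ := isCompact_uIcc.exists_bound_of_continuousOn hy
  have hB' := intervalIntegrable_iff.1 hB
  rw [intervalIntegrable_iff]
  have hym : AEStronglyMeasurable y (volume.restrict (uIoc a b)) :=
    (hy.aestronglyMeasurable measurableSet_uIcc).mono_measure
      (Measure.restrict_mono uIoc_subset_uIcc le_rfl)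
  refine Integrable.mono' (hB'.norm.mul_const C)
    (ContinuousLinearMap.aestronglyMeasurable_comp₂ (ContinuousLinearMap.apply ℝ E).flip
      hB'.aestronglyMeasurable hym) ?_
  rw [ae_restrict_iff' measurableSet_uIoc]
  refine Eventually.of_forall fun τ hτ => (B τ).le_of_opNorm_le_of_le le_rfl ?_
  exact hC τ (uIoc_subset_uIcc hτ)

/-- Terms of the Picard series of `x = h + ∫ B x`. -/
def picardTerm (B : ℝ → E →L[ℝ] E) (h : ℝ → E) : ℕ → ℝ → E
  | 0 => h
  | k + 1 => fun t => ∫ τ in (0 : ℝ)..t, B τ (picardTerm B h k τ)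

theorem continuousOn_picardTerm {B : ℝ → E →L[ℝ] E} {h : ℝ → E} {N : ℝ}
    (hB : IntervalIntegrable B volume 0 N) (hh : ContinuousOn h (uIcc 0 N)) (k : ℕ) :
    ContinuousOn (picardTerm B h k) (uIcc 0 N) := by
  induction k with
  | zero => exact hh
  | succ k ih =>
    exact intervalIntegral.continuousOn_primitive_interval
      ((intervalIntegrable_iff' (by simp)).1 (intervalIntegrable_clm_apply hB ih))

theorem norm_picardTerm_le {B : ℝ → E →L[ℝ] E} {h : ℝ → E} {N C : ℝ}
    (hB : IntervalIntegrable B volume 0 N) (hC : ∀ t ∈ Icc 0 N, ‖h t‖ ≤ C) (k : ℕ) :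
    ∀ t ∈ Icc 0 N, ‖picardTerm B h k t‖ ≤
      C * ((∫ r in (0 : ℝ)..t, ‖B r‖) ^ k / k.factorial) := by
  induction k with
  | zero => simpa [picardTerm] using hC
  | succ k ih =>
    intro t ht
    have hBt : IntervalIntegrable B volume 0 t :=
      hB.mono_set (uIcc_subset_uIcc_left (by rwa [uIcc_of_le (ht.1.trans ht.2)]))
    have hprim : ContinuousOn (fun τ => ∫ r in (0 : ℝ)..τ, ‖B r‖) (uIcc 0 t) :=
      intervalIntegral.continuousOn_primitive_interval ((intervalIntegrable_iff' (by simp)).1 hBt.norm)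
    rw [← integral_mul_primitive_pow hBt.norm, ← intervalIntegral.integral_const_mul]
    refine intervalIntegral.norm_integral_le_of_norm_le ht.1 (Eventually.of_forall fun τ hτ => ?_)
      ((hBt.norm.mul_continuousOn ((hprim.pow k).div_const _)).const_mul C)
    refine ((B τ).le_of_opNorm_le_of_le le_rfl (ih τ ⟨hτ.1.le, hτ.2.trans ht.2⟩)).trans_eq ?_
    ring

variable [CompleteSpace E]

/-- The factorial bounds make the Picard series converge uniformly on every `[0, N]`, so no local
solutions need gluing; dominated convergence allows termwise integration. -/
theorem exists_solution_integral_equation {B : ℝ → E →L[ℝ] E} {h : ℝ → E}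
    (hB : ∀ N, 0 ≤ N → IntervalIntegrable B volume 0 N)
    (hh : ∀ N, 0 ≤ N → ContinuousOn h (Icc 0 N)) :
    ∃ x : ℝ → E, (∀ N, 0 ≤ N → ContinuousOn x (Icc 0 N)) ∧
      ∀ t, 0 ≤ t → x t = h t + ∫ τ in (0 : ℝ)..t, B τ (x τ) := by
  have key : ∀ N, 0 ≤ N → ∃ u : ℕ → ℝ, Summable u ∧
      ∀ k, ∀ t ∈ Icc 0 N, ‖picardTerm B h k t‖ ≤ u k := by
    intro N hN
    obtain ⟨C, hC⟩ := isCompact_Icc.exists_bound_of_continuousOn (hh N hN)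
    have hC0 : 0 ≤ C := (norm_nonneg _).trans (hC 0 ⟨le_rfl, hN⟩)
    refine ⟨fun k => C * ((∫ r in (0 : ℝ)..N, ‖B r‖) ^ k / k.factorial),
      (Real.summable_pow_div_factorial _).mul_left C, fun k t ht => ?_⟩
    refine (norm_picardTerm_le (hB N hN) hC k t ht).trans ?_
    have h0 : 0 ≤ ∫ r in (0 : ℝ)..t, ‖B r‖ :=
      intervalIntegral.integral_nonneg ht.1 fun _ _ => norm_nonneg _
    have hmono : ∫ r in (0 : ℝ)..t, ‖B r‖ ≤ ∫ r in (0 : ℝ)..N, ‖B r‖ :=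
      intervalIntegral.integral_mono_interval le_rfl ht.1 ht.2
        (Eventually.of_forall fun _ => norm_nonneg _) (hB N hN).norm
    exact mul_le_mul_of_nonneg_left (div_le_div_of_nonneg_right (pow_le_pow_left₀ h0 hmono k)
      (Nat.cast_nonneg _)) hC0
  have hcont : ∀ N, 0 ≤ N → ∀ k, ContinuousOn (picardTerm B h k) (Icc 0 N) := fun N hN k => by
    have := continuousOn_picardTerm (hB N hN) (by rw [uIcc_of_le hN]; exact hh N hN) k
    rwa [uIcc_of_le hN] at this
  refine ⟨fun t => ∑' k, picardTerm B h k t, fun N hN => ?_, fun t ht => ?_⟩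
  · obtain ⟨u, hu, hb⟩ := key N hN
    exact continuousOn_tsum (hcont N hN) hu hb
  · obtain ⟨u, hu, hb⟩ := key t ht
    have hs : ∀ τ ∈ Icc 0 t, Summable fun k => picardTerm B h k τ := fun τ hτ =>
      Summable.of_norm_bounded hu fun k => hb k τ hτ
    refine (hs t ⟨ht, le_rfl⟩).tsum_eq_zero_add.trans ?_
    congr 1
    refine HasSum.tsum_eq (intervalIntegral.hasSum_integral_of_dominated_convergence
      (fun k τ => ‖B τ‖ * u k) (fun k => ?_) (fun k => ?_) ?_ ?_ ?_)
    · exact (intervalIntegrable_iff.1 (intervalIntegrable_clm_apply (hB t ht)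
        (by rw [uIcc_of_le ht]; exact hcont t ht k))).aestronglyMeasurable
    · refine Eventually.of_forall fun τ hτ => (B τ).le_of_opNorm_le_of_le le_rfl (hb k τ ?_)
      rw [← uIcc_of_le ht]
      exact uIoc_subset_uIcc hτ
    · exact Eventually.of_forall fun τ _ => hu.mul_left _
    · simp_rw [tsum_mul_left]
      exact (hB t ht).norm.mul_const _
    · refine Eventually.of_forall fun τ hτ => (B τ).hasSum (hs τ ?_).hasSum
      rw [← uIcc_of_le ht]
      exact uIoc_subset_uIcc hτ

/-- Carathéodory solution of a linear initial value problem on `[0, ∞)`. -/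
theorem exists_forward_solution {B : ℝ → E →L[ℝ] E} {b : ℝ → E}
    (hB : ∀ N, 0 ≤ N → IntervalIntegrable B volume 0 N)
    (hb : ∀ N, 0 ≤ N → IntervalIntegrable b volume 0 N) (x₀ : E) :
    ∃ x : ℝ → E, x 0 = x₀ ∧ (∀ t, 0 ≤ t → AbsolutelyContinuousOnInterval x 0 t) ∧
      ∀ᵐ t : ℝ, 0 ≤ t → HasDerivAt x (B t (x t) + b t) t := by
  have hcb : ∀ N, 0 ≤ N → ContinuousOn (fun t => x₀ + ∫ τ in (0 : ℝ)..t, b τ) (Icc 0 N) :=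
    fun N hN => by
      rw [← uIcc_of_le hN]
      exact (absolutelyContinuousOnInterval_primitive (hb N hN) x₀).continuousOn
  obtain ⟨y, hy, hsol⟩ := exists_solution_integral_equation hB hcb
  have hBy : ∀ N, 0 ≤ N → IntervalIntegrable (fun τ => B τ (y τ)) volume 0 N := fun N hN =>
    intervalIntegrable_clm_apply (hB N hN) (by rw [uIcc_of_le hN]; exact hy N hN)
  have hg : ∀ N, 0 ≤ N → IntervalIntegrable (fun τ => B τ (y τ) + b τ) volume 0 N :=
    fun N hN => (hBy N hN).add (hb N hN)
  have hxy : ∀ t, 0 ≤ t → x₀ + ∫ τ in (0 : ℝ)..t, (B τ (y τ) + b τ) = y t := fun t ht => by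
    rw [hsol t ht, intervalIntegral.integral_add (hBy t ht) (hb t ht)]
    abel
  -- The primitive is the witness rather than `y`: the two are known to agree only for `t ≥ 0`, and
  -- the primitive can be differentiated directly.
  refine ⟨fun t => x₀ + ∫ τ in (0 : ℝ)..t, (B τ (y τ) + b τ), by simp,
    fun t ht => absolutelyContinuousOnInterval_primitive (hg t ht) x₀, ?_⟩
  have : ∀ᵐ t : ℝ, ∀ N : ℕ, t ∈ uIcc (0 : ℝ) N →
      HasDerivAt (fun t => ∫ τ in (0 : ℝ)..t, (B τ (y τ) + b τ)) (B t (y t) + b t) t := by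
    rw [ae_all_iff]
    intro N
    filter_upwards [(hg N N.cast_nonneg).ae_hasDerivAt_integral] with t ht hmem
    exact ht hmem 0 left_mem_uIcc
  filter_upwards [this] with t ht h0
  obtain ⟨N, hN⟩ := exists_nat_ge t
  rw [hxy t h0]
  exact (ht N (by rw [uIcc_of_le N.cast_nonneg]; exact ⟨h0, hN⟩)).const_add x₀

/-- Carathéodory solution of a homogeneous linear terminal value problem on `[0, T]`. -/
theorem exists_backward_solution {B : ℝ → E →L[ℝ] E} {T : ℝ} (hT : 0 ≤ T)
    (hB : IntervalIntegrable B volume 0 T) (p : E) :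
    ∃ q : ℝ → E, q T = p ∧ AbsolutelyContinuousOnInterval q 0 T ∧
      ∀ᵐ t : ℝ, t ∈ Icc 0 T → HasDerivAt q (-(B t (q t))) t := by
  -- Time reversal turns the terminal condition into an initial one; cutting off outside `[0, T]`
  -- gives the integrability on every `[0, N]` that the forward result requires.
  let D : ℝ → E →L[ℝ] E := (Icc 0 T).indicator fun r => B (T - r)
  have hrev : IntervalIntegrable (fun r => B (T - r)) volume 0 T := by
    simpa using (hB.comp_sub_left T).symm
  have hD : Integrable D := by
    refine IntegrableOn.integrable_indicator (f := fun r => B (T - r)) ?_ measurableSet_Icc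
    rwa [← intervalIntegrable_iff_integrableOn_Icc_of_le hT]
  obtain ⟨y, hy, hsol⟩ := exists_solution_integral_equation (h := fun _ => p)
    (fun N _ => hD.intervalIntegrable) (fun N _ => continuousOn_const)
  have hyT : ContinuousOn (fun r => y (T - r)) (uIcc 0 T) := by
    rw [uIcc_of_le hT]
    exact (hy T hT).comp (by fun_prop) fun r hr => ⟨by linarith [hr.2], by linarith [hr.1]⟩
  have hg : IntervalIntegrable (fun τ => -(B τ (y (T - τ)))) volume 0 T :=
    (intervalIntegrable_clm_apply hB hyT).neg
  let q : ℝ → E := fun t => y T + ∫ τ in (0 : ℝ)..t, -(B τ (y (T - τ)))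
  have hq : ∀ t ∈ Icc 0 T, q t = y (T - t) := by
    intro t ht
    have e : ∀ s, 0 ≤ s → s ≤ T → y s = p + ∫ τ in (T - s)..T, B τ (y (T - τ)) := by
      intro s hs hsT
      rw [hsol s hs]
      congr 1
      have := intervalIntegral.integral_comp_sub_left (a := 0) (b := s)
        (fun τ => B τ (y (T - τ))) T
      rw [sub_zero] at this
      rw [← this]
      refine intervalIntegral.integral_congr fun r hr => ?_
      rw [uIcc_of_le hs] at hr
      have : r ∈ Icc 0 T := ⟨hr.1, hr.2.trans hsT⟩
      simp [D, this.1, this.2]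
    have h1 := e T hT le_rfl
    have h2 := e (T - t) (by linarith [ht.2]) (by linarith [ht.1])
    rw [sub_self] at h1
    rw [sub_sub_cancel] at h2
    have hI := intervalIntegrable_clm_apply hB hyT
    have ht' : t ∈ uIcc 0 T := by rwa [uIcc_of_le hT]
    have h3 := intervalIntegral.integral_add_adjacent_intervals
      (hI.mono_set (uIcc_subset_uIcc_left ht')) (hI.mono_set (uIcc_subset_uIcc_right ht'))
    simp only [q, intervalIntegral.integral_neg]
    rw [h1, h2, ← h3]
    abel
  refine ⟨q, ?_, absolutelyContinuousOnInterval_primitive hg _, ?_⟩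
  · rw [hq T ⟨hT, le_rfl⟩, sub_self, hsol 0 le_rfl]
    simp
  · filter_upwards [hg.ae_hasDerivAt_integral] with t ht hmem
    rw [hq t hmem]
    exact (ht (by rwa [uIcc_of_le hT]) 0 left_mem_uIcc).const_add _

end LinearODE

/-! ### Matrix coefficients and contact points -/

variable {n : ℕ}

theorem intervalIntegrable_sum_smul {F ι κ : Type*} [NormedAddCommGroup F] [NormedSpace ℝ F]
    [Fintype ι] [Fintype κ] {c : ℝ → ι → κ → ℝ} {a b : ℝ}
    (hc : ∀ i j, IntervalIntegrable (fun t => c t i j) volume a b) (D : ι → κ → F) :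
    IntervalIntegrable (fun t => ∑ i, ∑ j, c t i j • D i j) volume a b := by
  rw [intervalIntegrable_iff]
  exact integrable_finsetSum _ fun i _ => integrable_finsetSum _ fun j _ =>
    (intervalIntegrable_iff.1 (hc i j)).smul_const (D i j)

theorem toEuclideanLin_eq_sum (M : Matrix (Fin n) (Fin n) ℝ) :
    LinearMap.toContinuousLinearMap (Matrix.toEuclideanLin M) =
      ∑ i, ∑ j, M i j • LinearMap.toContinuousLinearMap
        (Matrix.toEuclideanLin (Matrix.single i j (1 : ℝ))) := by
  conv_lhs => rw [Matrix.matrix_eq_sum_single M]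
  simp only [map_sum, ← map_smul, Matrix.smul_single, smul_eq_mul, mul_one]

theorem intervalIntegrable_toEuclideanLin {A : ℝ → Matrix (Fin n) (Fin n) ℝ} {a b : ℝ}
    (hA : ∀ i j, IntervalIntegrable (fun t => A t i j) volume a b) :
    IntervalIntegrable
      (fun t => LinearMap.toContinuousLinearMap (Matrix.toEuclideanLin (A t))) volume a b := by
  rw [funext fun t => toEuclideanLin_eq_sum (A t)]
  exact intervalIntegrable_sum_smul hA _

theorem inner_toEuclideanLin_transpose (M : Matrix (Fin n) (Fin n) ℝ)
    (x y : EuclideanSpace ℝ (Fin n)) :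
    ⟪Matrix.toEuclideanLin M.transpose x, y⟫ = ⟪x, Matrix.toEuclideanLin M y⟫ := by
  rw [← Matrix.conjTranspose_eq_transpose_of_trivial, Matrix.toEuclideanLin_conjTranspose_eq_adjoint,
    LinearMap.adjoint_inner_left]

theorem contactPoint_spec {M : Set (State n)} {p : Costate n}
    (h : ∃ s ∈ M, ∀ s' ∈ M, ⟪p, s'⟫ ≤ ⟪p, s⟫) :
    contactPoint M p ∈ M ∧ ∀ s ∈ M, ⟪p, s⟫ ≤ ⟪p, contactPoint M p⟫ := by
  rw [contactPoint, dif_pos h]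
  exact h.choose_spec

/-! ### Reachable sets -/

namespace LinearPlant

variable (P : LinearPlant n)

theorem intervalIntegrable_A (i j : Fin n) {t : ℝ} (ht : 0 ≤ t) :
    IntervalIntegrable (fun τ => P.A τ i j) volume 0 t := by
  rw [intervalIntegrable_iff_integrableOn_Icc_of_le ht]
  exact (P.locallyIntegrable_A i j).integrableOn_compact_subset Icc_subset_Ici_self isCompact_Icc

variable {P}

theorem exists_isTrajectory {u : ℝ → State n} (hu : u ∈ P.admissible) :
    ∃ s, P.IsTrajectory u s := by
  obtain ⟨C, hC⟩ := P.isCompact_U.isBounded.exists_norm_le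
  have hb : ∀ N : ℝ, 0 ≤ N → IntervalIntegrable u volume 0 N := fun N hN => by
    refine (intervalIntegrable_const (c := C)).mono_fun hu.1.aestronglyMeasurable ?_
    rw [EventuallyLE, ae_restrict_iff' measurableSet_uIoc]
    refine Eventually.of_forall fun τ hτ => ?_
    rw [uIoc_of_le hN] at hτ
    exact (hC _ (hu.2 τ hτ.1.le)).trans (le_abs_self C)
  obtain ⟨s, h0, hac, hd⟩ := exists_forward_solution
    (fun N hN => intervalIntegrable_toEuclideanLin fun i j => P.intervalIntegrable_A i j hN)
    hb P.s₀
  exact ⟨s, h0, hac, hd⟩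

/-- An admissible control satisfying the maximum principle for the costate with terminal value `p`
maximizes `p` over the reachable set. -/
theorem exists_max_reachable (p : Costate n) {t : ℝ} (ht : 0 ≤ t) :
    ∃ x ∈ P.reachable t, ∀ y ∈ P.reachable t, ⟪p, y⟫ ≤ ⟪p, x⟫ := by
  obtain ⟨q, hqt, hqac, hqd⟩ := exists_backward_solution ht
    (intervalIntegrable_toEuclideanLin (A := fun τ => (P.A τ).transpose)
      fun i j => P.intervalIntegrable_A j i ht) p
  obtain ⟨σ, hσ, hmax⟩ := exists_measurable_argmax P.isCompact_U P.nonempty_U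
  -- The control must be measurable on all of `ℝ`, but `q` is known to be continuous only on `[0,
  -- t]`; hence the constant extension.
  obtain ⟨g, hg, hgq⟩ : ∃ g : ℝ → State n, Continuous g ∧ ∀ τ ∈ Icc 0 t, g τ = q τ := by
    have := hqac.continuousOn
    rw [uIcc_of_le ht] at this
    exact ⟨_, this.domRestrict.Icc_extend', fun τ hτ => IccExtend_of_mem ht _ hτ⟩
  have hu : (fun τ => σ (g τ)) ∈ P.admissible :=
    ⟨hσ.comp hg.measurable, fun τ _ => (hmax _).1⟩
  obtain ⟨s, hs⟩ := exists_isTrajectory hu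
  refine ⟨s t, ⟨_, hu, s, hs, rfl⟩, ?_⟩
  rintro _ ⟨v, hv, r, hr, rfl⟩
  have hac := absolutelyContinuousOnInterval_inner hqac
    ((hr.absolutelyContinuous t ht).sub (hs.absolutelyContinuous t ht))
  -- The pairing of `q` with `r - s` vanishes at `0`. The terms in `A` cancel by the adjoint
  -- equation, leaving a derivative that is nonpositive by the choice of `σ`.
  have hle := AbsolutelyContinuousOnInterval.sub_le_of_deriv_le (C := 0)
    (f' := fun τ => ⟪q τ, v τ - σ (q τ)⟫) hac ht ?_ ?_
  · simp only [Pi.sub_apply, hr.initial, hs.initial, sub_self, inner_zero_right, hqt, zero_mul,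
      sub_zero, inner_sub_right] at hle
    linarith
  · filter_upwards [hqd, hr.hasDerivAt, hs.hasDerivAt] with τ h1 h2 h3 hτ
    refine ((h1 hτ).inner ℝ ((h2 hτ.1).sub (h3 hτ.1))).congr_deriv ?_
    simp only [LinearMap.coe_toContinuousLinearMap', velocity, Pi.sub_apply, inner_neg_left,
      inner_toEuclideanLin_transpose, hgq τ hτ,
      inner_sub_right, inner_add_right]
    ring
  · refine Eventually.of_forall fun τ hτ => ?_
    rw [inner_sub_right]
    linarith [(hmax (q τ)).2 (v τ) (hv.2 τ hτ.1)]

theorem contactPoint_reachable_spec (p : Costate n) {t : ℝ} (ht : 0 ≤ t) :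
    contactPoint (P.reachable t) p ∈ P.reachable t ∧
      ∀ x ∈ P.reachable t, ⟪p, x⟫ ≤ ⟪p, contactPoint (P.reachable t) p⟫ :=
  contactPoint_spec (exists_max_reachable p ht)

/-- The support function of the reachable set grows at rate at most `vR`. -/
theorem RP2.inner_contactPoint_sub_le {vR : ℝ} (h : P.RP2 vR) (p : Costate n) {t₁ t₂ : ℝ}
    (h₁ : 0 ≤ t₁) (h₁₂ : t₁ ≤ t₂) :
    ⟪p, contactPoint (P.reachable t₂) p⟫ - ⟪p, contactPoint (P.reachable t₁) p⟫ ≤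
      ‖p‖ * vR * (t₂ - t₁) := by
  have h₂ := h₁.trans h₁₂
  obtain ⟨u, hu, s, hs, hst⟩ := (contactPoint_reachable_spec (P := P) p h₂).1
  -- The trajectory optimal at `t₂` is a competitor at `t₁`.
  have hmax := (contactPoint_reachable_spec (P := P) p h₁).2 (s t₁) ⟨u, hu, s, hs, rfl⟩
  have hsac := (hs.absolutelyContinuous t₂ h₂).mono (c := t₁) (d := t₂)
    (uIcc_subset_uIcc_right (by rw [uIcc_of_le h₂]; exact ⟨h₁, h₁₂⟩))
  have hac := absolutelyContinuousOnInterval_of_dist_le (hsac.const_smul ‖p‖)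
    (g := fun t => ⟪p, s t⟫) fun x _ y _ => by
      simp only [dist_eq_norm, ← inner_sub_right, ← smul_sub, norm_smul, norm_norm]
      exact norm_inner_le_norm _ _
  have hle := AbsolutelyContinuousOnInterval.sub_le_of_deriv_le (C := ‖p‖ * vR)
    (f' := fun τ => ⟪p, P.velocity τ (s τ) (u τ)⟫) hac h₁₂ ?_ ?_
  · rw [← hst]
    linarith
  · filter_upwards [hs.hasDerivAt] with τ hd hτ
    simpa using (hasDerivAt_const τ p).inner ℝ (hd (h₁.trans hτ.1))
  · refine Eventually.of_forall fun τ hτ => (real_inner_le_norm _ _).trans ?_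
    exact mul_le_mul_of_nonneg_left (h.2 u hu s hs τ (h₁.trans hτ.1)) (norm_nonneg p)

end LinearPlant

/-! ### Target sets and the lower distance estimate -/

theorem RT1.contactPoint_spec {G : ℝ → Set (State n)} (h : RT1 G) (t : ℝ) (p : Costate n) :
    contactPoint (G t) p ∈ G t ∧ ∀ s ∈ G t, ⟪p, s⟫ ≤ ⟪p, contactPoint (G t) p⟫ := by
  obtain ⟨s, hs, hmax⟩ := (h.isCompact t).exists_isMaxOn (h.nonempty t)
    (f := fun s => ⟪p, s⟫) (by fun_prop)
  exact MinTime.contactPoint_spec ⟨s, hs, fun s' hs' => hmax hs'⟩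

theorem RT4.norm_contactPoint_sub_le {G : ℝ → Set (State n)} {vG : ℝ} (h : RT4 G vG)
    {p : Costate n} (hp : p ≠ 0) (t₁ t₂ : ℝ) :
    ‖contactPoint (G t₂) p - contactPoint (G t₁) p‖ ≤ vG * ‖t₂ - t₁‖ :=
  convex_univ.norm_image_sub_le_of_norm_deriv_le (𝕜 := ℝ)
    (fun t _ => h.differentiable_contact p hp t) (fun t _ => h.norm_contactVelocity_le t p hp)
    (mem_univ t₁) (mem_univ t₂)

theorem norm_mul_rhoLower {P : LinearPlant n} {G : ℝ → Set (State n)} {p : Costate n}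
    (hp : p ≠ 0) (t : ℝ) :
    ‖p‖ * rhoLower P G t p =
      ⟪p, contactPoint (G t) (-p)⟫ - ⟪p, contactPoint (P.reachable t) p⟫ := by
  rw [rhoLower, real_inner_smul_left, mul_inv_cancel_left₀ (norm_ne_zero_iff.2 hp),
    inner_sub_right]

/-- The lower distance estimate decreases at rate at most `vG + vR`. -/
theorem rhoLower_ge {P : LinearPlant n} {G : ℝ → Set (State n)} {vR vG : ℝ}
    (hR : P.RP2 vR) (hG : RT4 G vG) {p : Costate n} (hp : p ≠ 0) {T t : ℝ} (hT : 0 ≤ T)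
    (hTt : T ≤ t) :
    rhoLower P G T p - (vG + vR) * (t - T) ≤ rhoLower P G t p := by
  have hp' : 0 < ‖p‖ := norm_pos_iff.2 hp
  have h1 := hR.inner_contactPoint_sub_le p hT hTt
  have h2 := hG.norm_contactPoint_sub_le (neg_ne_zero.2 hp) T t
  rw [Real.norm_of_nonneg (sub_nonneg.2 hTt)] at h2
  have h3 := (real_inner_le_norm (-p) _).trans (mul_le_mul_of_nonneg_left h2 (norm_nonneg (-p)))
  rw [norm_neg, inner_neg_left, inner_sub_right] at h3
  refine le_of_mul_le_mul_left ?_ hp'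
  rw [mul_sub, norm_mul_rhoLower hp, norm_mul_rhoLower hp]
  linarith

theorem le_inner_of_mem_target {G : ℝ → Set (State n)} (h : RT1 G) (t : ℝ) (p : Costate n)
    {y : State n} (hy : y ∈ G t) : ⟪p, contactPoint (G t) (-p)⟫ ≤ ⟪p, y⟫ := by
  simpa using (h.contactPoint_spec t (-p)).2 y hy

end MinTime

end

open MinTime in
theorem mainTheorem5 {n : ℕ} (P : LinearPlant n) (G : ℝ → Set (State n)) (vR vG : ℝ)
    (hRP1 : P.RP1) (hRP2 : P.RP2 vR) (hRT4 : RT4 G vG)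
    (T : ℝ) (hT : 0 ≤ T) (p : Costate n) (hp : p ≠ 0) (hpos : 0 < rhoLower P G T p) :
    (∀ t ∈ Set.Ico T (simpleBoost P G vR vG T p), 0 < rhoLower P G t p) ∧
    0 ≤ rhoLower P G (simpleBoost P G vR vG T p) p ∧
    (∀ t ∈ Set.Ico T (simpleBoost P G vR vG T p), ∃ c : ℝ,
      (∀ x ∈ P.reachable t, ⟪p, x⟫ < c) ∧ (∀ y ∈ G t, c < ⟪p, y⟫)) ∧
    (∃ c : ℝ, (∀ x ∈ P.reachable (simpleBoost P G vR vG T p), ⟪p, x⟫ ≤ c) ∧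
      (∀ y ∈ G (simpleBoost P G vR vG T p), c ≤ ⟪p, y⟫)) := by
  have hp' : 0 < ‖p‖ := norm_pos_iff.2 hp
  have hv : 0 < vG + vR := add_pos_of_nonneg_of_pos hRT4.nonneg hRP2.1
  have hf : simpleBoost P G vR vG T p = T + rhoLower P G T p / (vG + vR) := if_pos hpos.le
  have hTf : T ≤ simpleBoost P G vR vG T p := by
    rw [hf]
    exact le_add_of_nonneg_right (div_nonneg hpos.le hv.le)
  have h1 : ∀ t ∈ Set.Ico T (simpleBoost P G vR vG T p), 0 < rhoLower P G t p := by
    intro t ht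
    have h := rhoLower_ge hRP2 hRT4 hp hT ht.1
    have hlt : t - T < rhoLower P G T p / (vG + vR) := by linarith [hf, ht.2]
    rw [lt_div_iff₀' hv] at hlt
    linarith
  have h2 : 0 ≤ rhoLower P G (simpleBoost P G vR vG T p) p := by
    -- At the boosting time the linear lower bound is exactly zero.
    refine le_trans (le_of_eq ?_) (rhoLower_ge hRP2 hRT4 hp hT hTf)
    rw [hf]
    field_simp
    ring
  refine ⟨h1, h2, fun t ht => ?_, ?_⟩
  · have hgap := mul_pos hp' (h1 t ht)
    rw [norm_mul_rhoLower hp] at hgap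
    obtain ⟨c, hc1, hc2⟩ := exists_between (sub_pos.1 hgap)
    exact ⟨c, fun x hx =>
        ((LinearPlant.contactPoint_reachable_spec p (hT.trans ht.1)).2 x hx).trans_lt hc1,
      fun y hy => hc2.trans_le (le_inner_of_mem_target hRT4.toRT1 t p hy)⟩
  · have hgap := mul_nonneg hp'.le h2
    rw [norm_mul_rhoLower hp] at hgap
    exact ⟨_, (LinearPlant.contactPoint_reachable_spec p (hT.trans hTf)).2, fun y hy =>
      (sub_nonneg.1 hgap).trans (le_inner_of_mem_target hRT4.toRT1 _ p hy)⟩
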